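/- Let $\mathbb{S}=\{I\in\mathbb{H} : I^2=-1\}$ and, for $z\in\mathbb{C}$ and $I\in\mathbb{S}$, put $\pi(z,I)=\mathrm{Re}(z)+I\,\mathrm{Im}(z)\in\mathbb{H}$. Let $\mathcal{U}\subseteq\mathbb{C}$ be an open set that is invariant under complex conjugation, and let $U=\pi(\mathcal{U}\times\mathbb{S})\subseteq\mathbb{H}$. Let $f:U\to\mathbb{H}$ be slice regular, that is, there is a holomorphic map $F=F_0+\sqrt{-1}\,F_1:\mathcal{U}\to\mathbb{C}\otimes_{\mathbb{R}}\mathbb{H}\cong\mathbb{C}^4$, with $F_0,F_1$ taking values in $\mathbb{H}$, such that $F(\overline z)=\overline{F(z)}=F_0(z)-\sqrt{-1}\,F_1(z)$ for all $z\in\mathcal{U}$ and $f(\pi(z,I))=F_0(z)+I\,F_1(z)$ for all $z\in\mathcal{U}$, $I\in\mathbb{S}$. Let $$C_0(f)=\{q\in U : \text{the real differential } Df_q \text{ is singular}\},\qquad C(f)=f(C_0(f)),\qquad S(f)=f^{-1}(C(f))\subseteq U$$ be the set of critical points, the set of critical values and the singular locus of $f$. Suppose that $f$ is a finite map, in the sense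 that $f:U\to f(U)$ is a closed map and $f^{-1}(p)$ is finite for every $p\in\mathbb{H}\setminus C(f)$. (This holds in particular whenever $f:U\to\mathbb{H}$ is a closed, for instance a proper, map with finite fibres.) Then $f(U\setminus S(f))\subseteq\mathbb{H}\setminus C(f)$, and the restriction $$f|_{U\setminus S(f)}:U\setminus S(f)\longrightarrow f(U\setminus S(f))$$ is a covering map. -/

import Mathlib

open scoped Quaternion ComplexConjugate

namespace SliceReg

/-- The sphere `𝕊` of imaginary units of the quaternions. -/
def imagUnits : Set ℍ[ℝ] := {I | I * I = -1}

/-- The point `π(z, I) = Re z + I Im z` of `ℍ`. -/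
noncomputable def point (z : ℂ) (I : ℍ[ℝ]) : ℍ[ℝ] :=
  (z.re : ℍ[ℝ]) + I * (z.im : ℍ[ℝ])

/-- The circularization `U = π(𝒰 × 𝕊)` of `𝒰 ⊆ ℂ`. -/
def circularization (𝒰 : Set ℂ) : Set ℍ[ℝ] :=
  {q | ∃ z ∈ 𝒰, ∃ I ∈ imagUnits, point z I = q}

/-! The complexification `ℂ ⊗ ℍ` is realised as the algebra `ℍ[ℂ]` of quaternions with complex
coefficients: the element `w₀ + √-1 w₁` with `w₀, w₁ ∈ ℍ` is the one whose four complex coordinates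
have real parts the coordinates of `w₀` and imaginary parts the coordinates of `w₁`. -/

/-- The component `w₀` of `w = w₀ + √-1 w₁ ∈ ℂ ⊗ ℍ`. -/
def part0 (w : ℍ[ℂ]) : ℍ[ℝ] := ⟨w.re.re, w.imI.re, w.imJ.re, w.imK.re⟩

/-- The component `w₁` of `w = w₀ + √-1 w₁ ∈ ℂ ⊗ ℍ`. -/
def part1 (w : ℍ[ℂ]) : ℍ[ℝ] := ⟨w.re.im, w.imI.im, w.imJ.im, w.imK.im⟩

/-- The complex conjugation `w₀ + √-1 w₁ ↦ w₀ - √-1 w₁` of `ℂ ⊗ ℍ`. -/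
def complexConj (w : ℍ[ℂ]) : ℍ[ℂ] := ⟨conj w.re, conj w.imI, conj w.imJ, conj w.imK⟩

/-- The map `π(w₀ + √-1 w₁, I) = w₀ + I w₁` from `(ℂ ⊗ ℍ) × 𝕊` to `ℍ`. -/
noncomputable def proj (w : ℍ[ℂ]) (I : ℍ[ℝ]) : ℍ[ℝ] := part0 w + I * part1 w

/-- `F : 𝒰 → ℂ ⊗ ℍ` is a stem function (in particular `𝒰` is stable under conjugation). -/
structure IsStemFunction (𝒰 : Set ℂ) (F : ℂ → ℍ[ℂ]) : Prop where
  conj_mem : ∀ z ∈ 𝒰, conj z ∈ 𝒰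
  map_conj : ∀ z ∈ 𝒰, F (conj z) = complexConj (F z)

/-- `F : 𝒰 → ℂ ⊗ ℍ ≅ ℂ⁴` is holomorphic, i.e. its four complex coordinates are. -/
structure IsHolomorphic (𝒰 : Set ℂ) (F : ℂ → ℍ[ℂ]) : Prop where
  re : DifferentiableOn ℂ (fun z => (F z).re) 𝒰
  imI : DifferentiableOn ℂ (fun z => (F z).imI) 𝒰
  imJ : DifferentiableOn ℂ (fun z => (F z).imJ) 𝒰
  imK : DifferentiableOn ℂ (fun z => (F z).imK) 𝒰

/-- `f` restricts on `π(𝒰 × 𝕊)` to the slice function `𝓘(F)` induced by `F`. -/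
def IsInducedBy (𝒰 : Set ℂ) (F : ℂ → ℍ[ℂ]) (f : ℍ[ℝ] → ℍ[ℝ]) : Prop :=
  ∀ z ∈ 𝒰, ∀ I ∈ imagUnits, f (point z I) = proj (F z) I

/-- `f` is slice regular on `U = π(𝒰 × 𝕊)`: it is induced by a holomorphic stem function. Only the
values of `f` on `U` matter. -/
def IsSliceRegular (𝒰 : Set ℂ) (f : ℍ[ℝ] → ℍ[ℝ]) : Prop :=
  ∃ F : ℂ → ℍ[ℂ], IsStemFunction 𝒰 F ∧ IsHolomorphic 𝒰 F ∧ IsInducedBy 𝒰 F f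

/-- The critical points `C₀(f)`: the points of `U` at which the real differential is singular. -/
def criticalPoints (U : Set ℍ[ℝ]) (f : ℍ[ℝ] → ℍ[ℝ]) : Set ℍ[ℝ] :=
  {q | q ∈ U ∧ ¬ (fderiv ℝ f q).IsInvertible}

/-- The critical values `C(f) = f(C₀(f))`. -/
def criticalValues (U : Set ℍ[ℝ]) (f : ℍ[ℝ] → ℍ[ℝ]) : Set ℍ[ℝ] :=
  f '' criticalPoints U f

/-- The singular locus `S(f) = f⁻¹(C(f))`, a subset of `U`. -/
def singularLocus (U : Set ℍ[ℝ]) (f : ℍ[ℝ] → ℍ[ℝ]) : Set ℍ[ℝ] :=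
  U ∩ f ⁻¹' criticalValues U f

/-- `f : U → ℍ` is a finite map: it is closed onto its image, and the fibres over the points that
are not critical values are finite. Every closed (for instance, every proper) map `U → ℍ` with
finite fibres has this property; fibres over critical values may be infinite, as they are for
`q ↦ q ^ k`, `k ≥ 2`, whose fibre over `-1` or `1` contains 2-spheres. -/
structure IsFiniteMap (U : Set ℍ[ℝ]) (f : ℍ[ℝ] → ℍ[ℝ]) : Prop where
  closed : IsClosedMap (U.imageFactorization f)
  finite_fibers : ∀ p, p ∉ criticalValues U f → (U ∩ f ⁻¹' {p}).Finite

end SliceReg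

open Topology Filter

/-! Every point of `U` outside `S(f)` is noncritical. As `f` is `C¹`, the inverse function theorem
makes it a local homeomorphism there. A closed local homeomorphism with finite fibres on a Hausdorff
space is a covering: separate the points of a fibre by disjoint open sets mapped homeomorphically,
then use closedness to shrink the base until its preimage lies in their union.

The analytic content is `contDiffAt_of_isInducedBy`. Off the real axis, `f` is an explicit formula
in `Re q`, `|Im q|` and `Im q / |Im q|`, all smooth there. At real points these degenerate, and
`exists_analyticAt_point_comp` uses quaternionic power series instead. -/

/-- A map that is closed onto its image, has finite fibres outside `C` and is a local homeomorphism
off the preimage of `C` restricts to a covering map off that preimage. -/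
theorem isCoveringMap_imageFactorization_diff {X Y : Type*} [TopologicalSpace X]
    [TopologicalSpace Y] [T2Space X] {f : X → Y} {U : Set X} {C : Set Y} (hU : IsOpen U)
    (hclosed : IsClosedMap (U.imageFactorization f))
    (hfin : ∀ p ∉ C, (U ∩ f ⁻¹' {p}).Finite)
    (hloc : IsLocalHomeomorphOn f (U \ f ⁻¹' C)) :
    IsCoveringMap ((U \ (U ∩ f ⁻¹' C)).imageFactorization f) := by
  have hcov : IsCoveringMapOn (U.imageFactorization f) (Subtype.val ⁻¹' Cᶜ) := by
    refine hclosed.isCoveringMapOn_of_isLocalHomeomorphOn (fun p hp => ?_) ?_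
    · refine Set.Finite.of_finite_image (f := Subtype.val) ((hfin p hp).subset ?_)
        Subtype.val_injective.injOn
      rintro _ ⟨x, hx, rfl⟩
      exact ⟨x.2, congrArg Subtype.val hx⟩
    · rw [isLocalHomeomorphOn_iff_isOpenEmbedding_restrict]
      intro x hx
      obtain ⟨e, hxe, rfl⟩ := hloc x ⟨x.2, hx⟩
      -- Openness of `U` makes `W` open in `e.source`, so `e` restricts to an open embedding of `W`;
      -- this property then descends to the corestriction to `f '' U`.
      set W : Set U := Subtype.val ⁻¹' e.source with hW
      have hWo : IsOpen W := e.open_source.preimage continuous_subtype_val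
      have hemb : IsOpenEmbedding (fun w : W => e (w : U)) :=
        e.isOpenEmbedding_restrict.comp
          (f := fun w : W => (⟨(w : U), w.2⟩ : e.source))
          ⟨.of_comp (by fun_prop) continuous_subtype_val
            (g := (Subtype.val : {x // x ∈ e.source} → X))
            ((IsEmbedding.subtypeVal (p := (· ∈ U))).comp
              (IsEmbedding.subtypeVal (p := (· ∈ W))) :), by
            have : Set.range (fun w : W => (⟨(w : U), w.2⟩ : e.source)) =
                Subtype.val ⁻¹' U := by
              ext y
              exact ⟨fun ⟨w, hw⟩ => hw ▸ w.1.2, fun hy => ⟨⟨⟨y, hy⟩, y.2⟩, rfl⟩⟩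
            exact this ▸ hU.preimage continuous_subtype_val⟩
      refine ⟨W, hWo.mem_nhds hxe, ?_, ?_⟩
      · refine .of_comp ?_ continuous_subtype_val hemb.isEmbedding
        exact hemb.continuous.subtype_mk _
      · convert hemb.isOpen_range.preimage continuous_subtype_val using 1
        ext y
        exact ⟨fun ⟨w, hw⟩ => ⟨w, congrArg Subtype.val hw⟩, fun ⟨w, hw⟩ => ⟨w, Subtype.ext hw⟩⟩
  -- `g` and `k` only identify nested subtypes with the source and target of the statement.
  let g : ↥(U \ (U ∩ f ⁻¹' C)) ≃ₜ ↥(U.imageFactorization f ⁻¹' (Subtype.val ⁻¹' Cᶜ)) :=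
    { toFun x := ⟨⟨x, x.2.1⟩, fun h => x.2.2 ⟨x.2.1, h⟩⟩
      invFun x := ⟨x, x.1.2, fun h => x.2 h.2⟩
      left_inv _ := rfl
      right_inv _ := rfl
      continuous_toFun := by fun_prop
      continuous_invFun := by fun_prop }
  let k : ↥(Subtype.val ⁻¹' Cᶜ : Set (f '' U)) ≃ₜ ↥(f '' (U \ (U ∩ f ⁻¹' C))) :=
    { toFun y := ⟨y, by
        obtain ⟨⟨_, x, hx, rfl⟩, hy⟩ := y
        exact ⟨x, ⟨hx, fun h => hy h.2⟩, rfl⟩⟩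
      invFun y := ⟨⟨y, Set.image_mono Set.sdiff_subset y.2⟩, by
        obtain ⟨_, x, hx, rfl⟩ := y
        exact fun h => hx.2 ⟨hx.1, h⟩⟩
      left_inv _ := rfl
      right_inv _ := rfl
      continuous_toFun := by fun_prop
      continuous_invFun := by fun_prop }
  exact (hcov.isCoveringMap_restrictPreimage.comp_homeomorph g).homeomorph_comp k

namespace SliceReg

/-! ### Slice coordinates on the quaternions -/

/-- Being an algebra homomorphism `ℂ → ℍ`, `point · I` carries power series with real coefficients
to power series. -/
theorem point_eq_liftAux {I : ℍ[ℝ]} (hI : I * I = -1) (z : ℂ) :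
    point z I = Complex.liftAux I hI z := by
  rw [point, Complex.liftAux_apply, Quaternion.mul_coe_eq_smul]
  rfl

theorem re_eq_zero_of_mem_imagUnits {I : ℍ[ℝ]} (hI : I ∈ imagUnits) : I.re = 0 := by
  have hI : I * I = -1 := hI
  have hn : ‖I‖ * ‖I‖ = 1 := by rw [← norm_mul, hI, norm_neg, norm_one]
  rw [← Quaternion.sq_eq_neg_normSq, sq, hI, Quaternion.normSq_eq_norm_mul_self, hn]
  simp

theorem norm_eq_one_of_mem_imagUnits {I : ℍ[ℝ]} (hI : I ∈ imagUnits) : ‖I‖ = 1 := by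
  have hI : I * I = -1 := hI
  have hn : ‖I‖ * ‖I‖ = 1 := by rw [← norm_mul, hI, norm_neg, norm_one]
  nlinarith [norm_nonneg I]

theorem smul_im_mem_imagUnits {q : ℍ[ℝ]} (hq : q.im ≠ 0) : ‖q.im‖⁻¹ • q.im ∈ imagUnits := by
  have h := Quaternion.im_sq q
  rw [Quaternion.normSq_eq_norm_mul_self, sq] at h
  have hn : ‖q.im‖ ≠ 0 := norm_ne_zero_iff.2 hq
  change (‖q.im‖⁻¹ • q.im) * (‖q.im‖⁻¹ • q.im) = -1
  rw [smul_mul_smul_comm, h, smul_neg, ← Quaternion.coe_smul, smul_eq_mul]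
  field_simp
  simp

/-- The quaternion with the given real coordinates. -/
def ofCoords (a b c d : ℝ) : ℍ[ℝ] := ⟨a, b, c, d⟩

section ofCoords

variable (a b c d : ℝ)

@[simp] theorem re_ofCoords : (ofCoords a b c d).re = a := rfl
@[simp] theorem imI_ofCoords : (ofCoords a b c d).imI = b := rfl
@[simp] theorem imJ_ofCoords : (ofCoords a b c d).imJ = c := rfl
@[simp] theorem imK_ofCoords : (ofCoords a b c d).imK = d := rfl

end ofCoords

theorem part0_eq (w : ℍ[ℂ]) : part0 w = ofCoords w.re.re w.imI.re w.imJ.re w.imK.re := rfl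

theorem part1_eq (w : ℍ[ℂ]) : part1 w = ofCoords w.re.im w.imI.im w.imJ.im w.imK.im := rfl

/-- The representative of `q` in the closed upper half plane, `Re q + i |Im q|`. -/
noncomputable def upperRep (q : ℍ[ℝ]) : ℂ := ⟨q.re, ‖q.im‖⟩

theorem continuous_upperRep : Continuous upperRep := by
  have : Continuous fun q : ℍ[ℝ] => (q.re : ℂ) + (‖q.im‖ : ℂ) * Complex.I := by
    have := Quaternion.continuous_re
    have := Quaternion.continuous_im
    fun_prop
  convert this using 2 with q
  exact Complex.mk_eq_add_mul_I _ _

theorem point_upperRep {q : ℍ[ℝ]} (hq : q.im ≠ 0) :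
    point (upperRep q) (‖q.im‖⁻¹ • q.im) = q := by
  have hn : ‖q.im‖ ≠ 0 := norm_ne_zero_iff.2 hq
  rw [point, Quaternion.mul_coe_eq_smul, upperRep, smul_smul, mul_inv_cancel₀ hn, one_smul,
    Quaternion.re_add_im]

theorem exists_point_upperRep (q : ℍ[ℝ]) : ∃ I ∈ imagUnits, point (upperRep q) I = q := by
  by_cases hq : q.im = 0
  -- For real `q` any imaginary unit works.
  · refine ⟨ofCoords 0 1 0 0, ?_, ?_⟩
    · change _ * _ = _
      ext <;> simp
    · rw [point, upperRep, hq, norm_zero, Quaternion.coe_zero, mul_zero, add_zero,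
        ← add_zero (q.re : ℍ[ℝ]), ← hq, Quaternion.re_add_im]
  · exact ⟨_, smul_im_mem_imagUnits hq, point_upperRep hq⟩

theorem upperRep_point (z : ℂ) {I : ℍ[ℝ]} (hI : I ∈ imagUnits) :
    upperRep (point z I) = z ∨ upperRep (point z I) = conj z := by
  have h0 := re_eq_zero_of_mem_imagUnits hI
  have h1 := norm_eq_one_of_mem_imagUnits hI
  have hre : (point z I).re = z.re := by simp [point, Quaternion.mul_coe_eq_smul, h0]
  have him : (point z I).im = z.im • I := by
    rw [point, Quaternion.mul_coe_eq_smul]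
    ext <;> simp [h0]
  have hn : ‖(point z I).im‖ = |z.im| := by rw [him, norm_smul, h1, mul_one, Real.norm_eq_abs]
  rcases abs_choice z.im with h | h
  · exact .inl (Complex.ext hre (hn.trans h))
  · exact .inr (Complex.ext hre (hn.trans h))

theorem circularization_eq_preimage {𝒰 : Set ℂ} (h : ∀ z ∈ 𝒰, conj z ∈ 𝒰) :
    circularization 𝒰 = upperRep ⁻¹' 𝒰 := by
  ext q
  constructor
  · rintro ⟨z, hz, I, hI, rfl⟩
    rcases upperRep_point z hI with h' | h' <;> rw [Set.mem_preimage, h']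
    exacts [hz, h z hz]
  · intro hq
    obtain ⟨I, hI, h⟩ := exists_point_upperRep q
    exact ⟨_, hq, I, hI, h⟩

/-- Since `I` acts on the left and the basis `1, i, j, k` stands on the right, regularity reduces to
the four complex coordinates of the stem function. -/
theorem proj_eq_sum_point (w : ℍ[ℂ]) (I : ℍ[ℝ]) :
    proj w I = point w.re I + point w.imI I * ofCoords 0 1 0 0 + point w.imJ I * ofCoords 0 0 1 0 +
      point w.imK I * ofCoords 0 0 0 1 := by
  ext <;> simp [proj, point, part0_eq, part1_eq] <;> ring

/-! ### Slice regular functions are `C¹` -/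

/-- A holomorphic function that commutes with conjugation near a real point induces an analytic
function on the quaternions near that point: the sum of the same power series, whose coefficients
are real. -/
theorem exists_analyticAt_point_comp {h : ℂ → ℂ} {x : ℝ} (hh : AnalyticAt ℂ h x)
    (hconj : ∀ᶠ z in 𝓝 (x : ℂ), h (conj z) = conj (h z)) :
    ∃ S : ℍ[ℝ] → ℍ[ℝ], AnalyticAt ℝ S x ∧
      ∀ᶠ z in 𝓝 (x : ℂ), ∀ I ∈ imagUnits, S (point z I) = point (h z) I := by
  obtain ⟨p, r, hp⟩ := hh
  let c : ℕ → ℝ := fun n => (p.coeff n).re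
  let P := FormalMultilinearSeries.ofScalars ℍ[ℝ] c
  have hrad : p.radius ≤ P.radius := by
    refine FormalMultilinearSeries.radius_le_of_le fun n => ?_
    calc ‖P n‖ = ‖c n‖ := by simp [P]
      _ ≤ ‖p.coeff n‖ := Complex.abs_re_le_norm _
      _ = ‖p n‖ := p.norm_apply_eq_norm_coef.symm
  have hP := (P.hasFPowerSeriesOnBall (hp.r_pos.trans_le (hp.r_le.trans hrad))).comp_sub (x : ℍ[ℝ])
  rw [zero_add] at hP
  refine ⟨_, hP.analyticAt, ?_⟩
  filter_upwards [hconj, Metric.eball_mem_nhds (x : ℂ) hp.r_pos] with z hz hzr I hI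
  have hw : z - x ∈ Metric.eball (0 : ℂ) r := by
    simpa [edist_eq_enorm_sub] using hzr
  have hw' : conj (z - x) ∈ Metric.eball (0 : ℂ) r := by
    simpa [edist_eq_enorm_sub, ← map_sub] using hw
  have h1 := hp.hasSum hw
  have h2 := (hp.hasSum hw').map (starRingEnd ℂ) Complex.continuous_conj
  -- Averaging the series at `z` with the conjugate of the series at `conj z` replaces each
  -- coefficient by its real part and leaves the sum `h z` unchanged.
  have h3 : HasSum (fun n => (z - x) ^ n * (c n : ℂ)) (h z) := by
    have hx : (x : ℂ) + conj (z - x) = conj z := by simp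
    rw [hx, hz, Complex.conj_conj] at h2
    rw [add_sub_cancel] at h1
    have h3 := (h1.add h2).div_const 2
    rw [add_self_div_two] at h3
    refine Eq.mp (congrArg (HasSum · (h z)) (funext fun n => ?_)) h3
    simp only [Function.comp_apply, FormalMultilinearSeries.apply_eq_pow_smul_coeff, smul_eq_mul,
      map_mul, map_pow, Complex.conj_conj, c, Complex.re_eq_add_conj]
    ring
  have hI' : I * I = -1 := hI
  have hcont : Continuous (Complex.liftAux I hI') :=
    (Complex.liftAux I hI').toLinearMap.continuous_of_finiteDimensional
  have h4 := h3.map (Complex.liftAux I hI') hcont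
  have hsub : point z I - x = Complex.liftAux I hI' (z - x) := by
    rw [map_sub, point_eq_liftAux hI']
    congr 1
    simp
  have h5 : P.sum (point z I - x) = point (h z) I := by
    rw [point_eq_liftAux hI' (h z), ← h4.tsum_eq, FormalMultilinearSeries.sum]
    refine tsum_congr fun n => ?_
    rw [hsub]
    rw [Function.comp_apply, map_mul, map_pow, ← Complex.coe_algebraMap, AlgHom.commutes,
      ← Algebra.commutes, ← Algebra.smul_def]
    simp [P, FormalMultilinearSeries.ofScalars]
  exact h5

/-- A slice regular function is `C¹`. -/
theorem contDiffAt_of_isInducedBy {𝒰 : Set ℂ} (h𝒰 : IsOpen 𝒰) {F : ℂ → ℍ[ℂ]}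
    {f : ℍ[ℝ] → ℍ[ℝ]} (hF : IsStemFunction 𝒰 F) (hol : IsHolomorphic 𝒰 F)
    (hf : IsInducedBy 𝒰 F f) {q : ℍ[ℝ]} (hq : upperRep q ∈ 𝒰) : ContDiffAt ℝ 1 f q := by
  have hnhds : 𝒰 ∈ 𝓝 (upperRep q) := h𝒰.mem_nhds hq
  -- `‖q.im‖` is not differentiable where `q.im = 0`.
  by_cases him : q.im = 0
  · obtain ⟨x, rfl⟩ : ∃ x : ℝ, (x : ℍ[ℝ]) = q := ⟨q.re, by
      rw [← add_zero (q.re : ℍ[ℝ]), ← him, Quaternion.re_add_im]⟩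
    have hx : upperRep (x : ℍ[ℝ]) = x := by simp [upperRep, Complex.ext_iff]
    have hev := continuous_upperRep.tendsto (x : ℍ[ℝ])
    rw [hx] at hnhds hev
    have hmem : ∀ᶠ z in 𝓝 (x : ℂ), z ∈ 𝒰 := hnhds
    obtain ⟨S₀, hS₀, h₀⟩ := exists_analyticAt_point_comp (hol.re.analyticAt hnhds)
      (hmem.mono fun z hz => congrArg QuaternionAlgebra.re (hF.map_conj z hz))
    obtain ⟨S₁, hS₁, h₁⟩ := exists_analyticAt_point_comp (hol.imI.analyticAt hnhds)
      (hmem.mono fun z hz => congrArg QuaternionAlgebra.imI (hF.map_conj z hz))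
    obtain ⟨S₂, hS₂, h₂⟩ := exists_analyticAt_point_comp (hol.imJ.analyticAt hnhds)
      (hmem.mono fun z hz => congrArg QuaternionAlgebra.imJ (hF.map_conj z hz))
    obtain ⟨S₃, hS₃, h₃⟩ := exists_analyticAt_point_comp (hol.imK.analyticAt hnhds)
      (hmem.mono fun z hz => congrArg QuaternionAlgebra.imK (hF.map_conj z hz))
    have hS : ContDiffAt ℝ 1 (fun q => S₀ q + S₁ q * ofCoords 0 1 0 0 + S₂ q * ofCoords 0 0 1 0 +
        S₃ q * ofCoords 0 0 0 1) (x : ℍ[ℝ]) :=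
      ((hS₀.contDiffAt.add (hS₁.contDiffAt.mul contDiffAt_const)).add
        (hS₂.contDiffAt.mul contDiffAt_const)).add (hS₃.contDiffAt.mul contDiffAt_const)
    refine hS.congr_of_eventuallyEq ?_
    filter_upwards [hev.eventually hmem, hev.eventually h₀, hev.eventually h₁, hev.eventually h₂,
      hev.eventually h₃] with q hq k₀ k₁ k₂ k₃
    obtain ⟨I, hI, hqI⟩ := exists_point_upperRep q
    have k₀ := k₀ I hI
    have k₁ := k₁ I hI
    have k₂ := k₂ I hI
    have k₃ := k₃ I hI
    rw [hqI] at k₀ k₁ k₂ k₃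
    rw [k₀, k₁, k₂, k₃, ← proj_eq_sum_point, ← hf _ hq I hI, hqI]
  · have hre : ContDiff ℝ 1 fun q : ℍ[ℝ] => q.re :=
      ContinuousLinearMap.contDiff (𝕜 := ℝ)
        ⟨⟨⟨fun q => q.re, Quaternion.re_add⟩, fun r q => Quaternion.re_smul q r⟩,
          Quaternion.continuous_re⟩
    have himd : ContDiff ℝ 1 fun q : ℍ[ℝ] => q.im := by
      convert contDiff_id.sub (hre.smul (contDiff_const (c := (1 : ℍ[ℝ])))) using 2 with q
      change q.im = q - q.re • 1
      rw [← Quaternion.coe_mul_eq_smul, mul_one, eq_sub_iff_add_eq', Quaternion.re_add_im]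
    have hnorm : ContDiffAt ℝ 1 (fun q : ℍ[ℝ] => ‖q.im‖) q := himd.contDiffAt.norm ℝ him
    have hrep : ContDiffAt ℝ 1 upperRep q := by
      have : ContDiffAt ℝ 1 (fun q : ℍ[ℝ] => Complex.equivRealProdCLM.symm (q.re, ‖q.im‖)) q :=
        Complex.equivRealProdCLM.symm.contDiff.contDiffAt.comp q (hre.contDiffAt.prodMk hnorm)
      exact this
    have hunit : ContDiffAt ℝ 1 (fun q : ℍ[ℝ] => ‖q.im‖⁻¹ • q.im) q :=
      (hnorm.inv (norm_ne_zero_iff.2 him)).smul himd.contDiffAt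
    have key : ∀ h : ℂ → ℂ, DifferentiableOn ℂ h 𝒰 →
        ContDiffAt ℝ 1 (fun q => point (h (upperRep q)) (‖q.im‖⁻¹ • q.im)) q := by
      intro h hh
      have hc : ContDiffAt ℝ 1 (fun q => h (upperRep q)) q :=
        ((hh.analyticAt hnhds).contDiffAt.restrict_scalars ℝ).comp q hrep
      have hr : ContDiffAt ℝ 1 (fun q => (h (upperRep q)).re • (1 : ℍ[ℝ])) q :=
        (Complex.reCLM.contDiff.contDiffAt.comp q hc).smul contDiffAt_const
      have hi := (Complex.imCLM.contDiff.contDiffAt.comp q hc).smul hunit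
      refine (hr.add hi).congr_of_eventuallyEq (.of_forall fun q => ?_)
      simp [point, Quaternion.mul_coe_eq_smul, ← Quaternion.coe_mul_eq_smul]
    refine (((key _ hol.re).add
      ((key _ hol.imI).mul (contDiffAt_const (c := ofCoords 0 1 0 0)))).add
      ((key _ hol.imJ).mul (contDiffAt_const (c := ofCoords 0 0 1 0)))).add
      ((key _ hol.imK).mul (contDiffAt_const (c := ofCoords 0 0 0 1)))
        |>.congr_of_eventuallyEq ?_
    filter_upwards [continuous_upperRep.tendsto q |>.eventually hnhds,
      Quaternion.continuous_im.tendsto q |>.eventually_ne him] with q hq him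
    rw [← proj_eq_sum_point, ← hf _ hq _ (smul_im_mem_imagUnits him), point_upperRep him]

end SliceReg

theorem mainTheorem1 (𝒰 : Set ℂ) (h𝒰 : IsOpen 𝒰) (U : Set ℍ[ℝ])
    (hU : U = SliceReg.circularization 𝒰) (f : ℍ[ℝ] → ℍ[ℝ])
    (hf : SliceReg.IsSliceRegular 𝒰 f) (hfin : SliceReg.IsFiniteMap U f) :
    f '' (U \ SliceReg.singularLocus U f) ⊆ (SliceReg.criticalValues U f)ᶜ ∧
      IsCoveringMap ((U \ SliceReg.singularLocus U f).imageFactorization f) := by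
  obtain ⟨F, hF, hol, hind⟩ := hf
  refine ⟨?_, ?_⟩
  · rintro _ ⟨q, hq, rfl⟩ h
    exact hq.2 ⟨hq.1, h⟩
  have hU' : U = SliceReg.upperRep ⁻¹' 𝒰 :=
    hU.trans (SliceReg.circularization_eq_preimage hF.conj_mem)
  refine isCoveringMap_imageFactorization_diff
    (hU' ▸ h𝒰.preimage SliceReg.continuous_upperRep) hfin.closed hfin.finite_fibers ?_
  intro q hq
  have hc : ContDiffAt ℝ 1 f q := SliceReg.contDiffAt_of_isInducedBy h𝒰 hF hol hind (hU'.subset hq.1)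
  have hinv : (fderiv ℝ f q).IsInvertible := by
    by_contra h
    exact hq.2 ⟨q, ⟨hq.1, h⟩, rfl⟩
  obtain ⟨e, he⟩ := hinv
  have hs := hc.hasStrictFDerivAt one_ne_zero
  rw [← he] at hs
  exact ⟨hs.toOpenPartialHomeomorph f, hs.mem_toOpenPartialHomeomorph_source,
    hs.toOpenPartialHomeomorph_coe.symm⟩
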